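/- Write $\mathbf{u}=(1,1)$ and $\mathbf{d}=(1,-1)$. For integers $n,r\ge 0$ let $\mathcal{D}_{n,r}$ be the set of partial Dyck paths from $(0,0)$ to $(2n-r,r)$, i.e. prefixes of Dyck paths (lattice paths with steps $\mathbf{u},\mathbf{d}$ that start at the origin, never go below the $x$-axis and return to it at the end) that end at the point $(2n-r,r)$. A peak is an occurrence of $\mathbf{u}\mathbf{d}$ in such a path; it lies in a unique maximal mountain, i.e. a maximal run of consecutive steps of the form $\mathbf{u}^i\mathbf{d}^j$ with $i,j\ge 1$. The weight of the peak is $\min\{i,j\}$, and the peak is left asymmetric if $i>j$. For $k\ge 0$ let $L^P_{n,k,r}$ be the total number of left asymmetric peaks of weight $k+1$ over all paths in $\mathcal{D}_{n,r}$. Let $C(x)=\sum_{n\ge 0}\frac{1}{n+1}\binom{2n}{n}x^n$ be the generating function of the Catalan numbers. **Theorem.** For all integers $k,r\ge 0$, as formal power series, $$\sum_{n\ge 0}L^P_{n,k,r}\,x^n=\frac{x^{k+r+1}C(x)^{r-1}}{\sqrt{1-4x}}\Bigl(r+x^2C(x)^4\Bigr).$$ Moreover, for all $n\ge k+r+1$,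 $$L^P_{n,k,r}=r\binom{2(n-k)-r-3}{n-k-r-1}+\binom{2(n-k)-r-3}{n-k},$$ where a binomial coefficient with negative upper index (this occurs only for $r=0$, $n=k+1$) is read as $0$. -/

import Mathlib

namespace PartialDyck

/-- `partialDyckPaths n r`: the prefixes of Dyck paths running from `(0, 0)` to `(2n - r, r)`,
written as words in the steps `U = (1, 1)` and `D = (1, -1)`. The length condition is written
without subtraction, so the set is empty when `2n < r`. -/
def partialDyckPaths (n r : ℕ) : Set (List DyckStep) :=
  {l | (∃ w : DyckWord, l <+: w.toList) ∧
    l.length + r = 2 * n ∧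
    l.count DyckStep.U = l.count DyckStep.D + r}

/-- The word `l` has a peak (an occurrence of `UD`) whose middle point is reached after `p` steps,
and the maximal mountain containing this peak is `U ^ i D ^ j`: the factor `U ^ i D ^ j` with
`i, j ≥ 1` can be extended neither by a `U` on its left nor by a `D` on its right. -/
def HasPeakWithMountain (l : List DyckStep) (p i j : ℕ) : Prop :=
  1 ≤ i ∧ 1 ≤ j ∧ ∃ a b : List DyckStep,
    l = a ++ List.replicate i DyckStep.U ++ List.replicate j DyckStep.D ++ b ∧
    a.length + i = p ∧
    a.getLast? ≠ some DyckStep.U ∧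
    b.head? ≠ some DyckStep.D

/-- The word `l` has at position `p` a left asymmetric peak (maximal mountain `U ^ i D ^ j` with
`i > j`) of weight `min i j = m`. -/
def IsLeftAsymmetricPeak (l : List DyckStep) (p m : ℕ) : Prop :=
  ∃ i j : ℕ, HasPeakWithMountain l p i j ∧ j < i ∧ min i j = m

/-- Partial Dyck paths in `partialDyckPaths n r` with a distinguished left asymmetric peak of
weight `k + 1`; the peak is recorded by its position. -/
def markedPaths (n k r : ℕ) : Set (List DyckStep × ℕ) :=
  {q | q.1 ∈ partialDyckPaths n r ∧ IsLeftAsymmetricPeak q.1 q.2 (k + 1)}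

/-- There are finitely many marked paths, so that their number below is meaningful. -/
theorem markedPaths_finite (n k r : ℕ) : (markedPaths n k r).Finite := by
  have : Finite DyckStep := Finite.of_injective (fun s => decide (s = DyckStep.U))
    (fun s t h => by cases s <;> cases t <;> simp_all)
  refine Set.Finite.subset
    ((List.finite_length_le DyckStep (2 * n)).prod (Set.finite_Iic (2 * n))) ?_
  rintro ⟨l, p⟩ ⟨⟨-, hl, -⟩, i, j, ⟨-, -, a, b, h, hp, -⟩, -⟩
  have h2 := congrArg List.length h
  simp only [List.length_append, List.length_replicate] at h2
  simp only [Set.mem_prod, Set.mem_ofPred_eq, Set.mem_Iic] at *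
  omega

/-- The total number of left asymmetric peaks of weight `k + 1` over `partialDyckPaths n r`. -/
noncomputable def numLeftAsymmetricPeaks (n k r : ℕ) : ℕ := (markedPaths n k r).ncard

/-- The generating function `C(x)` of the Catalan numbers, with rational coefficients. -/
noncomputable def catalanGF : PowerSeries ℚ :=
  PowerSeries.map (Nat.castRingHom ℚ) PowerSeries.catalanSeries

/-- The formal power series `√(1 - 4x) = (1 - 4x) ^ (1/2)`, by the binomial series. -/
noncomputable def sqrtOneSubFourX : PowerSeries ℚ :=
  PowerSeries.rescale (-4 : ℚ) (PowerSeries.binomialSeries ℚ (1 / 2 : ℚ))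

/-- `sqrtOneSubFourX` squares to `1 - 4x`. -/
theorem sqrtOneSubFourX_sq : sqrtOneSubFourX ^ 2 = 1 - 4 * PowerSeries.X := by
  have h := PowerSeries.binomialSeries_nat (R := ℚ) (A := ℚ) 1
  have h2 := PowerSeries.binomialSeries_add (A := ℚ) (1 / 2 : ℚ) (1 / 2)
  rw [show (1 / 2 : ℚ) + 1 / 2 = ((1 : ℕ) : ℚ) by norm_num, h, pow_one] at h2
  have hC : (PowerSeries.C (-4 : ℚ)) = -4 := by
    rw [map_neg]; exact congrArg Neg.neg (map_ofNat (PowerSeries.C (R := ℚ)) 4)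
  rw [sqrtOneSubFourX, ← map_pow, sq, ← h2, map_add, map_one, PowerSeries.rescale_X, hC]
  ring

/-- `sqrtOneSubFourX` is the square root with constant term `1`; in particular it is invertible. -/
theorem constantCoeff_sqrtOneSubFourX : PowerSeries.constantCoeff sqrtOneSubFourX = 1 := by
  rw [← PowerSeries.coeff_zero_eq_constantCoeff_apply, sqrtOneSubFourX, PowerSeries.coeff_rescale]
  simp

/-- `catalanGF` has constant term `1`; in particular it is invertible. -/
theorem constantCoeff_catalanGF : PowerSeries.constantCoeff catalanGF = 1 := by
  rw [← PowerSeries.coeff_zero_eq_constantCoeff_apply, catalanGF, PowerSeries.coeff_map]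
  simp

end PartialDyck

/-!
The proof counts the marked paths by hand and then sums the resulting binomial coefficients.

*Contraction.* A left asymmetric peak of weight `k + 1` is the middle of a maximal mountain
`U ^ i D ^ (k + 1)` with `i ≥ k + 2`. Deleting the factor `U ^ (k + 1) D ^ (k + 1)` around the peak
leaves a path of the same final height with `k + 1` fewer steps of each kind, together with a marked
up step that is not followed by a down step; this is reversible (`bijOn_markedUps_markedPaths`). So
`k` only shifts the index, and with `m = n - k - 1` what is counted is the number of all up steps
minus the number of factors `U D`, over all paths with `m` up steps and `d = m - r` down steps that
stay nonnegative.

*Counting.* With `B u d` the number of such paths with `u` up and `d` down steps, the up steps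
number `m * B m d`, and deleting a factor `U D` leaves one of the `m + d - 1` gaps of a path counted
by `B (m - 1) (d - 1)` (`ncard_markedUps_succ`). The ballot numbers
`B u d = (u + d).choose u - (u + d).choose (u + 1)` (`ncard_nonnegPaths_add`) turn the difference
into the closed form (`ncard_markedUps_eq`).

*Summation.* `∑ t, (2 * t + s).choose t * x ^ t = C ^ s / √(1 - 4x)`
(`sqrtOneSubFourX_mul_binomGF`): for `s = 0` this is the derivative of `2xC = 1 - √(1 - 4x)`, for
`s = 1` it follows from `s = 0`, and Pascal's rule matches `C = 1 + x * C ^ 2` in the step.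
-/

namespace PartialDyck

open DyckStep

/-! ### Words that stay nonnegative -/

/-- The lattice path with step word `l` that starts at height `h` never goes below the `x`-axis. -/
def NonnegFrom : ℕ → List DyckStep → Prop
  | _, [] => True
  | h, U :: l => NonnegFrom (h + 1) l
  | 0, D :: _ => False
  | h + 1, D :: l => NonnegFrom h l

@[simp] lemma nonnegFrom_nil (h : ℕ) : NonnegFrom h [] := by
  simp [NonnegFrom]

@[simp] lemma nonnegFrom_U_cons (h : ℕ) (l : List DyckStep) :
    NonnegFrom h (U :: l) ↔ NonnegFrom (h + 1) l := by
  simp [NonnegFrom]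

@[simp] lemma not_nonnegFrom_zero_D_cons (l : List DyckStep) : ¬ NonnegFrom 0 (D :: l) := by
  simp [NonnegFrom]

@[simp] lemma nonnegFrom_succ_D_cons (h : ℕ) (l : List DyckStep) :
    NonnegFrom (h + 1) (D :: l) ↔ NonnegFrom h l := by
  simp [NonnegFrom]

lemma nonnegFrom_iff_take (h : ℕ) (l : List DyckStep) :
    NonnegFrom h l ↔ ∀ i, (l.take i).count D ≤ h + (l.take i).count U := by
  induction l generalizing h with
  | nil => simp
  | cons s l ih =>
    have key : (∀ i, ((s :: l).take i).count D ≤ h + ((s :: l).take i).count U) ↔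
        ∀ i, (s :: l.take i).count D ≤ h + (s :: l.take i).count U :=
      ⟨fun H i => by simpa using H (i + 1), fun H i => by cases i <;> simp [H]⟩
    rw [key]
    cases s with
    | U =>
      rw [nonnegFrom_U_cons, ih]
      refine forall_congr' fun i => ?_
      simp only [List.count_cons, beq_self_eq_true, if_true, beq_iff_eq, reduceCtorEq, if_false]
      omega
    | D =>
      cases h with
      | zero =>
        simp only [not_nonnegFrom_zero_D_cons, false_iff, not_forall]
        exact ⟨0, by simp⟩
      | succ h =>
        rw [nonnegFrom_succ_D_cons, ih]
        refine forall_congr' fun i => ?_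
        simp only [List.count_cons, beq_self_eq_true, if_true, beq_iff_eq, reduceCtorEq, if_false]
        omega

lemma nonnegFrom_replicate_U_append (h j : ℕ) (l : List DyckStep) :
    NonnegFrom h (List.replicate j U ++ l) ↔ NonnegFrom (h + j) l := by
  induction j generalizing h with
  | zero => simp
  | succ j ih =>
    rw [List.replicate_succ, List.cons_append, nonnegFrom_U_cons, ih, add_right_comm, add_assoc]

lemma nonnegFrom_replicate_D_append (h j : ℕ) (l : List DyckStep) :
    NonnegFrom (h + j) (List.replicate j D ++ l) ↔ NonnegFrom h l := by
  induction j with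
  | zero => simp
  | succ j ih =>
    rw [List.replicate_succ, List.cons_append, ← add_assoc, nonnegFrom_succ_D_cons, ih]

/-- Inserting `U ^ j D ^ j` anywhere in a word does not affect whether it stays nonnegative. -/
lemma nonnegFrom_insert_mountain (h j : ℕ) (a b : List DyckStep) :
    NonnegFrom h (a ++ (List.replicate j U ++ (List.replicate j D ++ b))) ↔
      NonnegFrom h (a ++ b) := by
  induction a generalizing h with
  | nil => simp [nonnegFrom_replicate_U_append, nonnegFrom_replicate_D_append]
  | cons s a ih => cases s <;> cases h <;> simp [ih]

lemma NonnegFrom.append_replicate_D {h j : ℕ} {l : List DyckStep} (hl : NonnegFrom h l)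
    (hj : h + l.count U = l.count D + j) : NonnegFrom h (l ++ List.replicate j D) := by
  induction l generalizing h with
  | nil =>
    have := (nonnegFrom_replicate_D_append 0 j []).2 (nonnegFrom_nil 0)
    simp_all
  | cons s l ih =>
    cases s with
    | U =>
      refine (nonnegFrom_U_cons _ _).2 (ih ((nonnegFrom_U_cons _ _).1 hl) ?_)
      simp at hj
      omega
    | D =>
      cases h with
      | zero => exact absurd hl (not_nonnegFrom_zero_D_cons _)
      | succ h =>
        refine (nonnegFrom_succ_D_cons _ _).2 (ih ((nonnegFrom_succ_D_cons _ _).1 hl) ?_)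
        simp at hj
        omega

/-- A word that stays nonnegative is completed to a Dyck word by a final descent, so the
prefixes of Dyck words are exactly the words that stay nonnegative. -/
lemma exists_prefix_dyckWord_iff (l : List DyckStep) :
    (∃ w : DyckWord, l <+: w.toList) ↔ NonnegFrom 0 l := by
  constructor
  · rintro ⟨w, hw⟩
    rw [nonnegFrom_iff_take]
    intro i
    have := w.count_D_le_count_U (min i l.length)
    rw [List.prefix_iff_eq_take.1 hw, List.take_take]
    simpa using this
  · intro hl
    have hle := (nonnegFrom_iff_take 0 l).1 hl l.length
    simp only [List.take_length, zero_add] at hle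
    have hw : NonnegFrom 0 (l ++ List.replicate (l.count U - l.count D) D) :=
      hl.append_replicate_D (by omega)
    refine ⟨⟨l ++ List.replicate (l.count U - l.count D) D, ?_, ?_⟩, List.prefix_append _ _⟩
    · simp [List.count_replicate]
      omega
    · simpa using (nonnegFrom_iff_take 0 _).1 hw

lemma length_eq_count_add_count (l : List DyckStep) : l.length = l.count U + l.count D := by
  induction l with
  | nil => rfl
  | cons s l ih => cases s <;> simp [ih] <;> omega

/-- The words with `u` up steps and `d` down steps that stay nonnegative when started at
height `h`. -/
def nonnegPaths (h u d : ℕ) : Set (List DyckStep) :=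
  {l | NonnegFrom h l ∧ l.count U = u ∧ l.count D = d}

lemma mem_partialDyckPaths_iff (n r : ℕ) (l : List DyckStep) :
    l ∈ partialDyckPaths n r ↔ NonnegFrom 0 l ∧ l.count U = n ∧ l.count D + r = n := by
  have := length_eq_count_add_count l
  simp only [partialDyckPaths, Set.mem_ofPred_eq, exists_prefix_dyckWord_iff]
  refine and_congr_right fun _ => ?_
  omega

lemma nonnegPaths_finite (h u d : ℕ) : (nonnegPaths h u d).Finite := by
  have : Finite DyckStep := Finite.of_injective (fun s => decide (s = U))
    (fun s t h => by cases s <;> cases t <;> simp_all)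
  refine (List.finite_length_le DyckStep (u + d)).subset ?_
  rintro l ⟨-, hu, hd⟩
  have := length_eq_count_add_count l
  simp only [Set.mem_ofPred_eq]
  omega

/-! ### The ballot numbers -/

lemma nonnegPaths_zero_left {h d : ℕ} (hd : d ≤ h) :
    nonnegPaths h 0 d = {List.replicate d D} := by
  ext l
  simp only [nonnegPaths, Set.mem_ofPred_eq, Set.mem_singleton_iff]
  constructor
  · rintro ⟨-, hu, hd⟩
    have hlen := length_eq_count_add_count l
    refine List.eq_replicate_iff.2 ⟨by omega, fun s hs => ?_⟩
    rcases s.dichotomy with rfl | rfl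
    · exact absurd hs (List.count_eq_zero.1 hu)
    · rfl
  · rintro rfl
    have := (nonnegFrom_replicate_D_append (h - d) d []).2 (nonnegFrom_nil _)
    rw [Nat.sub_add_cancel hd, List.append_nil] at this
    exact ⟨this, by simp [List.count_replicate], by simp⟩

lemma nonnegPaths_zero_right (h u : ℕ) : nonnegPaths h u 0 = {List.replicate u U} := by
  ext l
  simp only [nonnegPaths, Set.mem_ofPred_eq, Set.mem_singleton_iff]
  constructor
  · rintro ⟨-, hu, hd⟩
    have hlen := length_eq_count_add_count l
    refine List.eq_replicate_iff.2 ⟨by omega, fun s hs => ?_⟩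
    rcases s.dichotomy with rfl | rfl
    · rfl
    · exact absurd hs (List.count_eq_zero.1 hd)
  · rintro rfl
    have := (nonnegFrom_replicate_U_append h u []).2 (nonnegFrom_nil _)
    rw [List.append_nil] at this
    exact ⟨this, by simp, by simp [List.count_replicate]⟩

lemma nonnegPaths_zero_succ_succ (u d : ℕ) :
    nonnegPaths 0 (u + 1) (d + 1) = List.cons U '' nonnegPaths 1 u (d + 1) := by
  ext l
  cases l with
  | nil => simp [nonnegPaths]
  | cons s l => cases s <;> simp [nonnegPaths]

lemma nonnegPaths_succ_succ_succ (h u d : ℕ) :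
    nonnegPaths (h + 1) (u + 1) (d + 1) =
      List.cons U '' nonnegPaths (h + 2) u (d + 1) ∪ List.cons D '' nonnegPaths h (u + 1) d := by
  ext l
  cases l with
  | nil => simp [nonnegPaths]
  | cons s l => cases s <;> simp [nonnegPaths]

/-- The ballot numbers for an arbitrary starting height, without subtraction: the words that
reach height `-1` number `(u + d).choose (u + h + 1)`. -/
lemma ncard_nonnegPaths_add (h u d : ℕ) (hd : d ≤ u + h) :
    (nonnegPaths h u d).ncard + (u + d).choose (u + h + 1) = (u + d).choose u := by
  induction u generalizing h d with
  | zero =>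
    rw [nonnegPaths_zero_left (by omega), Set.ncard_singleton, Nat.choose_eq_zero_of_lt (by omega),
      Nat.choose_zero_right]
  | succ u ihu =>
    induction d generalizing h with
    | zero =>
      rw [nonnegPaths_zero_right, Set.ncard_singleton, Nat.choose_eq_zero_of_lt (by omega)]
      simp
    | succ d ihd =>
      have e : u + 1 + (d + 1) = (u + (d + 1)) + 1 := by omega
      cases h with
      | zero =>
        have h1 := ihu 1 (d + 1) (by omega)
        rw [nonnegPaths_zero_succ_succ, Set.ncard_image_of_injective _ (List.cons_injective), e,
          Nat.choose_succ_succ _ u, add_zero, Nat.choose_succ_succ _ (u + 1)]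
        simp only [Nat.succ_eq_add_one] at *
        omega
      | succ h =>
        have h1 := ihu (h + 2) (d + 1) (by omega)
        have h2 := ihd h (by omega)
        have hdisj : Disjoint (List.cons U '' nonnegPaths (h + 2) u (d + 1))
            (List.cons D '' nonnegPaths h (u + 1) d) := by
          rw [Set.disjoint_left]
          rintro _ ⟨a, -, rfl⟩ ⟨b, -, hb⟩
          simp at hb
        rw [nonnegPaths_succ_succ_succ, Set.ncard_union_eq hdisj
          ((nonnegPaths_finite _ _ _).image _) ((nonnegPaths_finite _ _ _).image _),
          Set.ncard_image_of_injective _ (List.cons_injective),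
          Set.ncard_image_of_injective _ (List.cons_injective), e,
          Nat.choose_succ_succ _ u, Nat.choose_succ_succ _ (u + 1 + (h + 1))]
        rw [show u + (h + 2) + 1 = u + 1 + (h + 1) + 1 by omega] at h1
        rw [show u + 1 + d = u + (d + 1) by omega, show u + 1 + h + 1 = u + 1 + (h + 1) by omega]
          at h2
        simp only [Nat.succ_eq_add_one] at *
        omega

/-! ### Words with a marked letter or a marked gap -/

lemma ncard_preimage_of_fiber {α β : Type*} (f : β → α) (N : ℕ) {S : Set α} (hS : S.Finite)
    (hfin : ∀ x, (f ⁻¹' {x}).Finite) (hf : ∀ x ∈ S, (f ⁻¹' {x}).ncard = N) :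
    (f ⁻¹' S).ncard = N * S.ncard := by
  induction S, hS using Set.Finite.induction_on with
  | empty => simp
  | @insert x S hx hS ih =>
    have hdisj : Disjoint (f ⁻¹' {x}) (f ⁻¹' S) :=
      Disjoint.preimage f (Set.disjoint_singleton_left.2 hx)
    rw [Set.insert_eq, Set.preimage_union, Set.ncard_union_eq hdisj (hfin x)
      (hS.preimage' fun b _ => hfin b), ← Set.insert_eq, Set.ncard_insert_of_notMem hx hS,
      hf x (Set.mem_insert _ _), ih fun y hy => hf y (Set.mem_insert_of_mem _ hy)]
    ring

lemma append_fiber {α : Type*} (l : List α) :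
    ((fun q : List α × List α => q.1 ++ q.2) ⁻¹' {l}).Finite ∧
      ((fun q : List α × List α => q.1 ++ q.2) ⁻¹' {l}).ncard = l.length + 1 := by
  induction l with
  | nil =>
    have : (fun q : List α × List α => q.1 ++ q.2) ⁻¹' {[]} = {([], [])} := by
      ext ⟨a, b⟩
      simp
    simp [this]
  | cons x l ih =>
    have hinj : Function.Injective (Prod.map (List.cons x) (id : List α → List α)) :=
      List.cons_injective.prodMap Function.injective_id
    have : (fun q : List α × List α => q.1 ++ q.2) ⁻¹' {x :: l} =
        insert ([], x :: l) (Prod.map (List.cons x) id ''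
          ((fun q : List α × List α => q.1 ++ q.2) ⁻¹' {l})) := by
      ext ⟨a, b⟩
      cases a <;> simp [eq_comm, and_comm]
    rw [this]
    refine ⟨(ih.1.image _).insert _, ?_⟩
    rw [Set.ncard_insert_of_notMem (by simp) (ih.1.image _), Set.ncard_image_of_injective _ hinj,
      ih.2, List.length_cons]

lemma append_cons_fiber {α : Type*} [DecidableEq α] (c : α) (l : List α) :
    ((fun q : List α × List α => q.1 ++ c :: q.2) ⁻¹' {l}).Finite ∧
      ((fun q : List α × List α => q.1 ++ c :: q.2) ⁻¹' {l}).ncard = l.count c := by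
  induction l with
  | nil =>
    have : (fun q : List α × List α => q.1 ++ c :: q.2) ⁻¹' {[]} = ∅ := by
      ext ⟨a, b⟩
      simp
    simp [this]
  | cons x l ih =>
    have hinj : Function.Injective (Prod.map (List.cons x) (id : List α → List α)) :=
      List.cons_injective.prodMap Function.injective_id
    by_cases hx : x = c
    · subst hx
      have : (fun q : List α × List α => q.1 ++ x :: q.2) ⁻¹' {x :: l} =
          insert ([], l) (Prod.map (List.cons x) id ''
            ((fun q : List α × List α => q.1 ++ x :: q.2) ⁻¹' {l})) := by
        ext ⟨a, b⟩
        cases a <;> simp [eq_comm, and_comm]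
      rw [this]
      refine ⟨(ih.1.image _).insert _, ?_⟩
      rw [Set.ncard_insert_of_notMem (by simp) (ih.1.image _),
        Set.ncard_image_of_injective _ hinj, ih.2, List.count_cons_self]
    · have : (fun q : List α × List α => q.1 ++ c :: q.2) ⁻¹' {x :: l} =
          Prod.map (List.cons x) id ''
            ((fun q : List α × List α => q.1 ++ c :: q.2) ⁻¹' {l}) := by
        ext ⟨a, b⟩
        cases a <;> simp [eq_comm, and_comm, Ne.symm hx]
      rw [this]
      refine ⟨ih.1.image _, ?_⟩
      rw [Set.ncard_image_of_injective _ hinj, ih.2, List.count_cons_of_ne hx]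

/-! ### Contracting the marked peak -/

/-- The ways to mark, in a word with `u` up steps and `d` down steps that stays nonnegative, an
up step that is not followed by a down step. The word is `q.1 ++ U :: q.2` and the displayed `U` is
the marked step. -/
def markedUps (u d : ℕ) : Set (List DyckStep × List DyckStep) :=
  {q | q.1 ++ U :: q.2 ∈ nonnegPaths 0 u d ∧ q.2.head? ≠ some D}

lemma insert_mountain_mem_nonnegPaths_iff (u d k : ℕ) (a b : List DyckStep) :
    a ++ List.replicate (k + 2) U ++ List.replicate (k + 1) D ++ b ∈
      nonnegPaths 0 (u + k + 1) (d + k + 1) ↔ a ++ U :: b ∈ nonnegPaths 0 u d := by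
  have h1 := nonnegFrom_insert_mountain 0 (k + 1) (a ++ [U]) b
  have e : a ++ List.replicate (k + 2) U ++ List.replicate (k + 1) D ++ b =
      a ++ [U] ++ (List.replicate (k + 1) U ++ (List.replicate (k + 1) D ++ b)) := by
    rw [List.replicate_succ (n := k + 1)]
    simp
  simp only [nonnegPaths, Set.mem_ofPred_eq]
  rw [e, h1, List.append_assoc, List.singleton_append]
  refine and_congr_right fun _ => ?_
  simp [List.count_replicate]
  omega

lemma exists_eq_append_replicate_U (a : List DyckStep) :
    ∃ (a' : List DyckStep) (j : ℕ), a = a' ++ List.replicate j U ∧ a'.getLast? ≠ some U := by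
  induction a using List.reverseRecOn with
  | nil => exact ⟨[], 0, by simp⟩
  | append_singleton a s ih =>
    rcases s.dichotomy with rfl | rfl
    · obtain ⟨a', j, rfl, h⟩ := ih
      exact ⟨a', j + 1, by rw [List.replicate_succ', List.append_assoc], h⟩
    · exact ⟨a ++ [D], 0, by simp⟩

/-- Inserting `U ^ (k + 1) D ^ (k + 1)` after the marked up step produces a peak of weight
`k + 1`: the descent has length exactly `k + 1` because no down step followed the marked step, and
the ascent is longer because it contains the marked step. -/
lemma bijOn_markedUps_markedPaths (d k r : ℕ) :
    Set.BijOn (fun q : List DyckStep × List DyckStep =>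
        (q.1 ++ List.replicate (k + 2) U ++ List.replicate (k + 1) D ++ q.2,
          q.1.length + (k + 2)))
      (markedUps (d + r) d) (markedPaths (d + r + k + 1) k r) := by
  have hmem (l : List DyckStep) : l ∈ partialDyckPaths (d + r + k + 1) r ↔
      l ∈ nonnegPaths 0 (d + r + k + 1) (d + k + 1) := by
    rw [mem_partialDyckPaths_iff]
    simp only [nonnegPaths, Set.mem_ofPred_eq]
    refine and_congr_right fun _ => and_congr_right fun _ => ?_
    omega
  refine ⟨?_, ?_, ?_⟩
  · rintro ⟨a, b⟩ ⟨h, hb⟩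
    obtain ⟨a', j, rfl, ha'⟩ := exists_eq_append_replicate_U a
    refine ⟨(hmem _).2 ((insert_mountain_mem_nonnegPaths_iff _ _ _ _ _).2 h),
      j + (k + 2), k + 1, ⟨by omega, by omega, a', b, ?_, ?_, ha', hb⟩, by omega, by omega⟩
    · simp [List.replicate_add]
    · simp
      omega
  · rintro ⟨a, b⟩ - ⟨a', b'⟩ - h
    simp only [Prod.mk.injEq, List.append_assoc] at h
    obtain ⟨rfl, h'⟩ := List.append_inj h.1 (by omega)
    have h := List.append_cancel_left (List.append_cancel_left h')
    rw [h]
  · rintro ⟨l, p⟩ ⟨hl, i, j, ⟨hi, hj, a, b, rfl, hp, -, hb⟩, hij, hmin⟩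
    obtain rfl : j = k + 1 := by omega
    obtain ⟨i, rfl⟩ : ∃ i', i = i' + (k + 2) := ⟨i - (k + 2), by omega⟩
    have e : a ++ List.replicate (i + (k + 2)) U ++ List.replicate (k + 1) D ++ b =
        (a ++ List.replicate i U) ++ List.replicate (k + 2) U ++ List.replicate (k + 1) D ++ b := by
      rw [List.replicate_add]
      simp
    refine ⟨(a ++ List.replicate i U, b), ⟨?_, hb⟩, ?_⟩
    · rw [← insert_mountain_mem_nonnegPaths_iff _ _ k, ← e]
      exact (hmem _).1 hl
    · simp only [Prod.mk.injEq]
      refine ⟨e.symm, ?_⟩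
      simp at hp ⊢
      omega

lemma numLeftAsymmetricPeaks_eq_ncard_markedUps (d k r : ℕ) :
    numLeftAsymmetricPeaks (d + r + k + 1) k r = (markedUps (d + r) d).ncard :=
  (bijOn_markedUps_markedPaths d k r).ncard_eq.symm

lemma numLeftAsymmetricPeaks_eq_zero {n k r : ℕ} (h : n < k + r + 1) :
    numLeftAsymmetricPeaks n k r = 0 := by
  have : markedPaths n k r = ∅ := by
    refine Set.eq_empty_of_forall_notMem ?_
    rintro ⟨l, p⟩ ⟨hl, i, j, ⟨hi, hj, a, b, rfl, -⟩, hij, hmin⟩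
    have := ((mem_partialDyckPaths_iff _ _ _).1 hl).2.2
    simp at this
    omega
  rw [numLeftAsymmetricPeaks, this, Set.ncard_empty]

/-! ### Counting the marked up steps -/

lemma finite_upSplits (u d : ℕ) :
    ((fun q : List DyckStep × List DyckStep => q.1 ++ U :: q.2) ⁻¹' nonnegPaths 0 u d).Finite :=
  (nonnegPaths_finite 0 u d).preimage' fun l _ => (append_cons_fiber U l).1

lemma ncard_upSplits (u d : ℕ) :
    ((fun q : List DyckStep × List DyckStep => q.1 ++ U :: q.2) ⁻¹' nonnegPaths 0 u d).ncard =
      u * (nonnegPaths 0 u d).ncard :=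
  ncard_preimage_of_fiber _ u (nonnegPaths_finite 0 u d) (fun l => (append_cons_fiber U l).1)
    fun l hl => (append_cons_fiber U l).2.trans hl.2.1

lemma ncard_splits (u d : ℕ) :
    ((fun q : List DyckStep × List DyckStep => q.1 ++ q.2) ⁻¹' nonnegPaths 0 u d).ncard =
      (u + d + 1) * (nonnegPaths 0 u d).ncard :=
  ncard_preimage_of_fiber _ (u + d + 1) (nonnegPaths_finite 0 u d) (fun l => (append_fiber l).1)
    fun l hl => by rw [(append_fiber l).2, length_eq_count_add_count, hl.2.1, hl.2.2]

lemma ncard_markedUps_zero (u : ℕ) : (markedUps u 0).ncard = u := by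
  have : markedUps u 0 =
      (fun q : List DyckStep × List DyckStep => q.1 ++ U :: q.2) ⁻¹' nonnegPaths 0 u 0 := by
    ext ⟨a, b⟩
    refine and_iff_left_of_imp fun h hb => ?_
    have hD := List.count_eq_zero.1 h.2.2
    exact hD (by simp [List.mem_of_head? hb])
  rw [this, ncard_upSplits, nonnegPaths_zero_right, Set.ncard_singleton, mul_one]

/-- Of all up steps, discard those followed by a down step. Deleting such a pair `U D` leaves a
shorter word with a marked gap. -/
lemma ncard_markedUps_succ (u d : ℕ) :
    (markedUps (u + 1) (d + 1)).ncard + (u + d + 1) * (nonnegPaths 0 u d).ncard =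
      (u + 1) * (nonnegPaths 0 (u + 1) (d + 1)).ncard := by
  have hsplit : (fun q : List DyckStep × List DyckStep => q.1 ++ U :: q.2) ⁻¹'
      nonnegPaths 0 (u + 1) (d + 1) = markedUps (u + 1) (d + 1) ∪ Prod.map id (List.cons D) ''
        ((fun q : List DyckStep × List DyckStep => q.1 ++ q.2) ⁻¹' nonnegPaths 0 u d) := by
    have hpeak (a b : List DyckStep) : a ++ U :: D :: b ∈ nonnegPaths 0 (u + 1) (d + 1) ↔
        a ++ b ∈ nonnegPaths 0 u d := by
      have h := nonnegFrom_insert_mountain 0 1 a b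
      simp only [List.replicate_one, List.singleton_append] at h
      simp only [nonnegPaths, Set.mem_ofPred_eq, h]
      refine and_congr_right fun _ => ?_
      simp
      omega
    ext ⟨a, b⟩
    rcases b with _ | ⟨s, b⟩
    · simp [markedUps]
    · rcases s.dichotomy with rfl | rfl
      · simp [markedUps]
      · simp [markedUps, hpeak]
  have hdisj : Disjoint (markedUps (u + 1) (d + 1)) (Prod.map id (List.cons D) ''
      ((fun q : List DyckStep × List DyckStep => q.1 ++ q.2) ⁻¹' nonnegPaths 0 u d)) := by
    rw [Set.disjoint_left]
    rintro _ h ⟨⟨a, b⟩, -, rfl⟩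
    exact h.2 (by simp)
  have hinj : Function.Injective (Prod.map (id : List DyckStep → List DyckStep) (List.cons D)) :=
    Function.injective_id.prodMap List.cons_injective
  have hfin := finite_upSplits (u + 1) (d + 1)
  have h := ncard_upSplits (u + 1) (d + 1)
  rw [hsplit] at hfin h
  rw [← h, Set.ncard_union_eq hdisj (hfin.subset Set.subset_union_left)
    (hfin.subset Set.subset_union_right), Set.ncard_image_of_injective _ hinj, ncard_splits]

/-- The closed form in terms of the numbers of steps of the contracted path; the number `r` of the
theorem is the final height `u - d`. -/
lemma ncard_markedUps_eq (d r : ℕ) :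
    (markedUps (d + r) d).ncard =
      r * (2 * d + r - 1).choose d + (2 * d + r - 1).choose (d + r + 1) := by
  cases d with
  | zero =>
    rw [ncard_markedUps_zero, Nat.choose_eq_zero_of_lt (show 2 * 0 + r - 1 < 0 + r + 1 by omega)]
    simp
  | succ q =>
    have h := ncard_markedUps_succ (q + r) q
    have h1 := ncard_nonnegPaths_add 0 (q + r) q (by omega)
    have h2 := ncard_nonnegPaths_add 0 (q + r + 1) (q + 1) (by omega)
    have e1 := Nat.add_one_mul_choose_eq (q + r + q) (q + r)
    have e2 := Nat.add_one_mul_choose_eq (q + r + q) (q + r + 1)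
    have e3 := Nat.choose_succ_right_eq (q + r + q + 1) (q + r)
    have e4 := Nat.choose_symm_of_eq_add (show q + r + q + 1 = (q + 1) + (q + r) by omega)
    have e5 := Nat.choose_succ_succ (q + r + q + 1) (q + r)
    have e6 := Nat.choose_succ_succ (q + r + q + 1) (q + r + 1)
    rw [show q + r + 1 + (q + 1) = (q + r + q + 1) + 1 by omega] at h2
    rw [show q + r + q + 1 - (q + r) = q + 1 by omega] at e3
    rw [show q + 1 + r = q + r + 1 by omega, show 2 * (q + 1) + r - 1 = q + r + q + 1 by omega, e4]
    simp only [Nat.succ_eq_add_one, add_zero] at *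
    zify at *
    linear_combination h - (q + r + q + 1) * h1 + (q + r + 1) * (h2 + e5 - e6) - e1 + e2 - e3

/-! ### Generating functions -/

open PowerSeries

lemma catalanGF_eq : catalanGF = 1 + X * catalanGF ^ 2 := by
  have h := congrArg (PowerSeries.map (Nat.castRingHom ℚ)) catalanSeries_sq_mul_X_add_one
  simp only [map_add, map_mul, map_pow, map_one, PowerSeries.map_X] at h
  rw [← catalanGF] at h
  linear_combination -h

/-- The quadratic formula for `C`: both sides are square roots of `1 - 4x` with constant
term `1`. -/
lemma one_sub_two_X_mul_catalanGF : 1 - 2 * X * catalanGF = sqrtOneSubFourX := by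
  have h : (1 - 2 * X * catalanGF - sqrtOneSubFourX) *
      (1 - 2 * X * catalanGF + sqrtOneSubFourX) = 0 := by
    linear_combination -4 * X * catalanGF_eq - sqrtOneSubFourX_sq
  rcases mul_eq_zero.1 h with h | h
  · exact sub_eq_zero.1 h
  · have := congrArg constantCoeff h
    simp [constantCoeff_sqrtOneSubFourX] at this

/-- The generating function of the binomial coefficients `(2 * t + s).choose t`. -/
noncomputable def binomGF (s : ℕ) : PowerSeries ℚ :=
  PowerSeries.mk fun t => ((2 * t + s).choose t : ℚ)

lemma binomGF_zero_eq_derivative : binomGF 0 = derivative ℚ (X * catalanGF) := by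
  ext t
  rw [coeff_derivative, coeff_succ_X_mul, binomGF, coeff_mk, catalanGF, coeff_map,
    catalanSeries_coeff, add_zero, ← Nat.centralBinom_eq_two_mul_choose,
    ← succ_mul_catalan_eq_centralBinom]
  push_cast
  simp [mul_comm]

/-- Differentiating `√(1 - 4x) ^ 2 = 1 - 4x`, where `√(1 - 4x) = 1 - 2xC` has derivative
`-2 * binomGF 0`. -/
lemma sqrtOneSubFourX_mul_binomGF_zero : sqrtOneSubFourX * binomGF 0 = 1 := by
  have h1 : derivative ℚ sqrtOneSubFourX = -2 * binomGF 0 := by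
    rw [← one_sub_two_X_mul_catalanGF, binomGF_zero_eq_derivative, mul_assoc, two_mul, map_sub,
      map_add, derivative_one]
    ring
  have h2 := congrArg (derivative ℚ) sqrtOneSubFourX_sq
  rw [sq, Derivation.leibniz, h1, map_sub, derivative_one,
    show (4 : PowerSeries ℚ) * X = X + X + X + X by ring] at h2
  simp only [map_add, derivative_X, smul_eq_mul] at h2
  have h4 : (4 : PowerSeries ℚ) ≠ 0 := by
    intro h
    have := congrArg constantCoeff h
    rw [map_ofNat, map_zero] at this
    norm_num at this
  refine mul_left_cancel₀ h4 ?_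
  linear_combination -h2

lemma two_X_mul_binomGF_one : 2 * X * binomGF 1 = binomGF 0 - 1 := by
  ext t
  rw [show 2 * X * binomGF 1 = X * binomGF 1 + X * binomGF 1 by ring]
  cases t with
  | zero => simp [binomGF]
  | succ t =>
    have h : (2 * t + 1 + 1).choose (t + 1) = (2 * t + 1).choose t + (2 * t + 1).choose t := by
      rw [Nat.choose_succ_succ, Nat.choose_symm_of_eq_add (show 2 * t + 1 = (t + 1) + t by omega)]
    rw [map_add, coeff_succ_X_mul, map_sub, coeff_one, if_neg (Nat.succ_ne_zero t)]
    simp only [binomGF, coeff_mk]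
    rw [show 2 * (t + 1) + 0 = 2 * t + 1 + 1 by ring, h]
    push_cast
    ring

lemma X_mul_binomGF_add_two (s : ℕ) : X * binomGF (s + 2) = binomGF (s + 1) - binomGF s := by
  ext t
  cases t with
  | zero => simp [binomGF]
  | succ t =>
    rw [coeff_succ_X_mul, map_sub]
    simp only [binomGF, coeff_mk]
    rw [show 2 * (t + 1) + (s + 1) = 2 * t + (s + 2) + 1 by ring,
      show 2 * (t + 1) + s = 2 * t + (s + 2) by ring, Nat.choose_succ_succ]
    push_cast
    ring

/-- `∑ t, (2 * t + s).choose t * x ^ t = C ^ s / √(1 - 4x)`. By Pascal's rule both sides satisfy the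
recursion that follows from `C = 1 + x * C ^ 2`. -/
lemma sqrtOneSubFourX_mul_binomGF (s : ℕ) : sqrtOneSubFourX * binomGF s = catalanGF ^ s := by
  induction s using Nat.twoStepInduction with
  | zero => rw [sqrtOneSubFourX_mul_binomGF_zero, pow_zero]
  | one =>
    have h2 : (2 : PowerSeries ℚ) ≠ 0 := by
      intro h
      have := congrArg constantCoeff h
      rw [map_ofNat, map_zero] at this
      norm_num at this
    refine mul_left_cancel₀ (mul_ne_zero h2 X_ne_zero) ?_
    linear_combination sqrtOneSubFourX * two_X_mul_binomGF_one + sqrtOneSubFourX_mul_binomGF_zero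
      + one_sub_two_X_mul_catalanGF
  | more s h0 h1 =>
    refine mul_left_cancel₀ X_ne_zero ?_
    linear_combination sqrtOneSubFourX * X_mul_binomGF_add_two s + h1 - h0
      + catalanGF ^ s * catalanGF_eq

lemma binomGF_eq (s : ℕ) : binomGF s = catalanGF ^ s * sqrtOneSubFourX⁻¹ := by
  rw [PowerSeries.eq_mul_inv_iff_mul_eq (by rw [constantCoeff_sqrtOneSubFourX]; exact one_ne_zero),
    mul_comm, sqrtOneSubFourX_mul_binomGF]

/-- For `r = 0` the term with `binomGF (r - 1)` is multiplied by `0`, so that the truncated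
subtraction does no harm. -/
lemma catalanGF_pow_mul_eq_binomGF (r : ℕ) :
    (catalanGF ^ r * catalanGF⁻¹) * ((r : PowerSeries ℚ) + X ^ 2 * catalanGF ^ 4) *
        sqrtOneSubFourX⁻¹ = (r : PowerSeries ℚ) * binomGF (r - 1) + X ^ 2 * binomGF (r + 3) := by
  have hC : catalanGF * catalanGF⁻¹ = 1 :=
    PowerSeries.mul_inv_cancel _ (by rw [constantCoeff_catalanGF]; exact one_ne_zero)
  rw [binomGF_eq, binomGF_eq]
  cases r with
  | zero =>
    rw [Nat.cast_zero]
    linear_combination X ^ 2 * catalanGF ^ 3 * sqrtOneSubFourX⁻¹ * hC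
  | succ r =>
    rw [Nat.add_sub_cancel]
    linear_combination catalanGF ^ r * (((r + 1 : ℕ) : PowerSeries ℚ) + X ^ 2 * catalanGF ^ 4) *
      sqrtOneSubFourX⁻¹ * hC

lemma coeff_binomGF_combination (r d : ℕ) :
    coeff d ((r : PowerSeries ℚ) * binomGF (r - 1) + X ^ 2 * binomGF (r + 3)) =
      ((r * (2 * d + r - 1).choose d + (2 * d + r - 1).choose (d + r + 1) : ℕ) : ℚ) := by
  have h1 : coeff d ((r : PowerSeries ℚ) * binomGF (r - 1)) =
      ((r * (2 * d + r - 1).choose d : ℕ) : ℚ) := by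
    rw [← map_natCast (C (R := ℚ)), coeff_C_mul, binomGF, coeff_mk]
    rcases r with _ | r
    · simp
    · rw [Nat.add_sub_cancel, show 2 * d + (r + 1) - 1 = 2 * d + r by omega]
      push_cast
      ring
  have h2 : coeff d (X ^ 2 * binomGF (r + 3)) =
      (((2 * d + r - 1).choose (d + r + 1) : ℕ) : ℚ) := by
    rw [coeff_X_pow_mul']
    split_ifs with hd
    · obtain ⟨e, rfl⟩ := Nat.exists_eq_add_of_le hd
      rw [binomGF, coeff_mk, Nat.add_sub_cancel_left,
        show 2 * (2 + e) + r - 1 = 2 * e + (r + 3) by omega,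
        Nat.choose_symm_of_eq_add (show 2 * e + (r + 3) = e + (2 + e + r + 1) by omega)]
    · rw [Nat.choose_eq_zero_of_lt (by omega), Nat.cast_zero]
  rw [map_add, h1, h2, Nat.cast_add]

/-! ### The number of left asymmetric peaks -/

lemma numLeftAsymmetricPeaks_eq (d k r : ℕ) :
    numLeftAsymmetricPeaks (d + r + k + 1) k r =
      r * (2 * d + r - 1).choose d + (2 * d + r - 1).choose (d + r + 1) := by
  rw [numLeftAsymmetricPeaks_eq_ncard_markedUps, ncard_markedUps_eq]

end PartialDyck

/-- The factor `C(x) ^ (r - 1)`, with possibly negative exponent, is written `C ^ r * C⁻¹`. The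
truncated subtraction `2 * (n - k) - r - 3` differs from the true one only for `r = 0`, `n = k + 1`,
where both summands are then `0`. -/
theorem theorem4p2p3 (k r : ℕ) :
    (PowerSeries.mk fun n : ℕ => (PartialDyck.numLeftAsymmetricPeaks n k r : ℚ)) =
      PowerSeries.X ^ (k + r + 1) *
        (PartialDyck.catalanGF ^ r * PartialDyck.catalanGF⁻¹) *
        ((r : PowerSeries ℚ) + PowerSeries.X ^ 2 * PartialDyck.catalanGF ^ 4) *
        PartialDyck.sqrtOneSubFourX⁻¹ ∧
    ∀ n : ℕ, k + r + 1 ≤ n →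
      PartialDyck.numLeftAsymmetricPeaks n k r =
        r * (2 * (n - k) - r - 3).choose (n - k - r - 1) +
          (2 * (n - k) - r - 3).choose (n - k) := by
  constructor
  · rw [mul_assoc, mul_assoc, ← mul_assoc (_ * _⁻¹), PartialDyck.catalanGF_pow_mul_eq_binomGF]
    ext n
    rw [PowerSeries.coeff_mk, PowerSeries.coeff_X_pow_mul']
    split_ifs with hn
    · obtain ⟨d, rfl⟩ : ∃ d, n = d + r + k + 1 := ⟨n - (k + r + 1), by omega⟩
      rw [PartialDyck.numLeftAsymmetricPeaks_eq,
        show d + r + k + 1 - (k + r + 1) = d by omega, PartialDyck.coeff_binomGF_combination]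
    · rw [PartialDyck.numLeftAsymmetricPeaks_eq_zero (by omega), Nat.cast_zero]
  · intro n hn
    obtain ⟨d, rfl⟩ : ∃ d, n = d + r + k + 1 := ⟨n - (k + r + 1), by omega⟩
    rw [PartialDyck.numLeftAsymmetricPeaks_eq,
      show 2 * (d + r + k + 1 - k) - r - 3 = 2 * d + r - 1 by omega,
      show d + r + k + 1 - k - r - 1 = d by omega, show d + r + k + 1 - k = d + r + 1 by omega]
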